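/- Let $n\ge 1$. A cube is a half-open cube $Q=\prod_{i=1}^n[a_i,a_i+\ell)\subset\mathbb R^n$ with $\ell>0$, and $|E|$ denotes Lebesgue measure. A dyadic grid $\mathcal D$ is a collection of cubes such that: (1) each $Q\in\mathcal D$ satisfies $|Q|=2^{nk}$ for some $k\in\mathbb Z$; (2) $Q\cap P\in\{\varnothing,P,Q\}$ for all $Q,P\in\mathcal D$; (3) for each $k\in\mathbb Z$ the cubes $Q\in\mathcal D$ with $|Q|=2^{nk}$ form a partition of $\mathbb R^n$. A family $\mathcal S\subset\mathcal D$ is sparse if for each $Q\in\mathcal S$ $$\Big|\bigcup_{Q'\in\mathcal S,\;Q'\subsetneq Q}Q'\Big|\le\tfrac12|Q| .$$ The associated sparse operator is $T^{\mathcal S}f=\sum_{Q\in\mathcal S}\big(\frac1{|Q|}\int_Q f\,dx\big)\chi_Q$. For $0<\epsilon\le1$ let $A_\epsilon(t)=t(1+\log^+t)^\epsilon$, $t\ge0$, and for a measurable function $w$ and a cube $Q$ put $$\|w\|_{A_\epsilon,Q}=\inf\Big\{\lambda>0:\frac1{|Q|}\int_Q A_\epsilon\Big(\frac{|w(x)|}{\lambda}\Big)dx\le1\Big\}\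 (\inf\varnothing=\infty),\qquad M_{L(\log L)^\epsilon}(w)(x)=\sup_{Q\ni x}\|w\|_{A_\epsilon,Q},$$ the supremum being over all cubes $Q$ containing $x$. A weight is a nonnegative locally integrable function $w$ on $\mathbb R^n$; write $w(E)=\int_E w\,dx$ and $\|g\|_{L^{1,\infty}(w)}=\sup_{\lambda>0}\lambda\,w(\{x:|g(x)|>\lambda\})$. **Proposition.** For every $n\ge1$ there is a constant $c\in(0,\infty)$, depending only on $n$, such that for every dyadic grid $\mathcal D$ in $\mathbb R^n$, every sparse family $\mathcal S\subset\mathcal D$, every $0<\epsilon\le1$, every weight $w$ and every locally integrable $f:\mathbb R^n\to\mathbb C$, $$\|T^{\mathcal S}f\|_{L^{1,\infty}(w)}\le\frac c\epsilon\int_{\mathbb R^n}|f(x)|\,M_{L(\log L)^\epsilon}(w)(x)\,dx .$$ Moreover, whenever the right-hand side is finite, the series defining $T^{\mathcal S}f(x)$ converges absolutely for $w$-almost every $x$, so that the left-hand side is meaningful. (When the right-hand side is infinite the inequality asserts nothing; products are understood with $0\cdot\infty=0$.) -/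

import Mathlib

open MeasureTheory Set
open scoped ENNReal

noncomputable section

namespace SparseEndpoint

/-- A cube in `ℝⁿ` with sides parallel to the axes, half-open: `∏ i, [a i, a i + ℓ)` with side
length `ℓ > 0`. -/
def IsCube {n : ℕ} (Q : Set (Fin n → ℝ)) : Prop :=
  ∃ (a : Fin n → ℝ) (ℓ : ℝ), 0 < ℓ ∧ Q = Set.univ.pi fun i => Set.Ico (a i) (a i + ℓ)

/-- A dyadic grid: a collection of cubes of measure `2 ^ (n k)`, `k ∈ ℤ`, any two of which are
disjoint or nested, such that for every `k` the cubes of measure `2 ^ (n k)` partition `ℝⁿ`. -/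
structure IsDyadicGrid {n : ℕ} (D : Set (Set (Fin n → ℝ))) : Prop where
  isCube : ∀ Q ∈ D, IsCube Q
  volume_eq : ∀ Q ∈ D, ∃ k : ℤ, volume Q = (2 : ℝ≥0∞) ^ ((n : ℤ) * k)
  nested : ∀ Q ∈ D, ∀ P ∈ D, Q ∩ P = ∅ ∨ Q ∩ P = P ∨ Q ∩ P = Q
  partition : ∀ k : ℤ, Setoid.IsPartition {Q ∈ D | volume Q = (2 : ℝ≥0∞) ^ ((n : ℤ) * k)}

/-- A family `S` is sparse if for each `Q ∈ S` the members of `S` strictly contained in `Q`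
together cover at most half of `Q`. -/
def IsSparse {n : ℕ} (S : Set (Set (Fin n → ℝ))) : Prop :=
  ∀ Q ∈ S, volume (⋃ Q' ∈ {Q' ∈ S | Q' ⊂ Q}, Q') ≤ volume Q / 2

/-- The value at `x` of the term `(⨍_Q f) χ_Q` of the sparse operator. -/
def sparseTerm {n : ℕ} (f : (Fin n → ℝ) → ℂ) (x : Fin n → ℝ) (Q : Set (Fin n → ℝ)) : ℂ :=
  Q.indicator (fun _ => ⨍ y in Q, f y) x

/-- The sparse operator `T^S f = ∑_{Q ∈ S} (⨍_Q f) χ_Q`. -/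
def sparseOp {n : ℕ} (S : Set (Set (Fin n → ℝ))) (f : (Fin n → ℝ) → ℂ) (x : Fin n → ℝ) : ℂ :=
  ∑' Q : S, sparseTerm f x (Q : Set (Fin n → ℝ))

/-- The Luxemburg norm `‖f‖_{A,E} = inf {t > 0 : ⨍_E A(|f| / t) ≤ 1}`, with `inf ∅ = ∞`. -/
def luxemburgNorm {n : ℕ} (A : ℝ → ℝ) (E : Set (Fin n → ℝ)) (f : (Fin n → ℝ) → ℝ) : ℝ≥0∞ :=
  ⨅ (t : ℝ) (_ : 0 < t) (_ : (⨍⁻ x in E, ENNReal.ofReal (A (|f x| / t)) ∂volume) ≤ 1), ENNReal.ofReal t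

/-- The Orlicz maximal function `M_A f(x) = sup_{Q ∋ x} ‖f‖_{A,Q}`, over all cubes containing
`x`. -/
def orliczMaximal {n : ℕ} (A : ℝ → ℝ) (f : (Fin n → ℝ) → ℝ) (x : Fin n → ℝ) : ℝ≥0∞ :=
  ⨆ (Q : Set (Fin n → ℝ)) (_ : IsCube Q) (_ : x ∈ Q), luxemburgNorm A Q f

/-- The Young function `A(t) = t (1 + log⁺ t)^ε` of the space `L (log L)^ε`. -/
def youngLLogL (ε t : ℝ) : ℝ := t * (1 + Real.posLog t) ^ ε

/-- The measure `w dx` with density the weight `w ≥ 0`. -/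
def weightMeasure {n : ℕ} (w : (Fin n → ℝ) → ℝ) : Measure (Fin n → ℝ) :=
  volume.withDensity fun x => ENNReal.ofReal (w x)

/-- The weak norm `‖g‖_{L^{1,∞}(μ)} = sup_{t > 0} t μ{|g| > t}`. -/
def weakL1Norm {n : ℕ} (μ : Measure (Fin n → ℝ)) (g : (Fin n → ℝ) → ℂ) : ℝ≥0∞ :=
  ⨆ (t : ℝ) (_ : 0 < t), ENNReal.ofReal t * μ {x | t < ‖g x‖}

end SparseEndpoint

end

open SparseEndpoint

/-!
The weak-type estimate is proved with the absolute constant `288`, by summing over levels of the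
averages of `|f|`.

By monotone convergence (a dyadic grid is countable) and homogeneity it suffices to bound
`w {∑_{Q ∈ F} ⨍_Q |f| χ_Q > 1}` for a finite sparse family `F`. The members of `F` with average
above `1/16` have a union `Ω` of small weight, since `⨍_Q w` is at most twice the Luxemburg norm
(`measure_large_averages_le`). On the remaining set `E`, only the layers `F_j` of cubes whose average
is comparable to `4⁻ʲ / 16` contribute. For one layer (`layer_estimate`) each `Q ∈ F_j` is cut into
its `m`-deep part, the `m`-th generation of its descendants in `F_j`, and the rest. The rests overlap at
most `m` times, which costs `m w(E)`. By sparseness the deep part has relative measure at most `2⁻ᵐ`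
(`measure_deepPart_le`), so the generalized Hölder inequality (`weightMeasure_le_luxemburgNorm`)
bounds its weight by `|Q| ‖w‖_{A_ε, Q}` times about `m⁻ᵋ`; and `|Q| 4⁻ʲ` is controlled by the
integral of `|f|` over `Q` minus four generations, sets of bounded overlap.

With `m = 2^(j+2)`, the multiples of `w(E)` sum to `w(E) / 2`, which is absorbed because `w(E)` is
finite, and the gains `2^(-jε)` sum to at most `2 / ε` (`finite_weak_estimate`).

The maximal function is never assumed measurable: only upper bounds by its lower integral over the
whole space are used. The operator `absSparseOp` with nonnegative terms dominates `‖T^S f‖`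
everywhere, and its finiteness almost everywhere gives the absolute convergence.
-/

namespace SparseEndpoint

/-! ### Finite sparse families in a measure space -/

section Families

variable {X : Type*}

/-- Any two members of the family are nested or disjoint. -/
def IsNested (G : Finset (Set X)) : Prop :=
  ∀ Q ∈ G, ∀ P ∈ G, Q ⊆ P ∨ P ⊆ Q ∨ Disjoint Q P

open Classical in
/-- The members of `G` that contain `x` and are strictly contained in `Q`. -/
noncomputable def below (G : Finset (Set X)) (Q : Set X) (x : X) : Finset (Set X) :=
  G.filter fun P => x ∈ P ∧ P ⊂ Q

/-- The points of `Q` lying in at least `m` members of `G` strictly inside `Q`. For a nested family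
this is the union of the `m`-th generation of descendants of `Q` in `G`. -/
def deepPart (G : Finset (Set X)) (Q : Set X) (m : ℕ) : Set X :=
  {x ∈ Q | m ≤ (below G Q x).card}

open Classical in
/-- The members of `G` that are maximal with respect to inclusion. -/
noncomputable def maximalMembers (G : Finset (Set X)) : Finset (Set X) :=
  G.filter fun Q => Maximal (· ∈ G) Q

theorem mem_below {G : Finset (Set X)} {Q P : Set X} {x : X} :
    P ∈ below G Q x ↔ P ∈ G ∧ x ∈ P ∧ P ⊂ Q := by
  simp [below]

theorem maximalMembers_subset (G : Finset (Set X)) : maximalMembers G ⊆ G := by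
  classical exact Finset.filter_subset _ _

theorem maximal_of_mem_maximalMembers {G : Finset (Set X)} {Q : Set X}
    (h : Q ∈ maximalMembers G) : Maximal (· ∈ G) Q := by
  classical exact (Finset.mem_filter.1 h).2

theorem exists_maximalMember {G : Finset (Set X)} {Q : Set X} (hQ : Q ∈ G) :
    ∃ P ∈ maximalMembers G, Q ⊆ P := by
  obtain ⟨P, hQP, hP⟩ := Finset.exists_le_maximal G hQ
  classical exact ⟨P, Finset.mem_filter.2 ⟨hP.prop, hP⟩, hQP⟩

theorem IsNested.mono {G H : Finset (Set X)} (hG : IsNested G) (h : H ⊆ G) : IsNested H :=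
  fun Q hQ P hP => hG Q (h hQ) P (h hP)

theorem IsNested.subset_or {G : Finset (Set X)} (hG : IsNested G) {Q P : Set X} (hQ : Q ∈ G)
    (hP : P ∈ G) {x : X} (hxQ : x ∈ Q) (hxP : x ∈ P) : Q ⊆ P ∨ P ⊆ Q := by
  rcases hG Q hQ P hP with h | h | h
  · exact Or.inl h
  · exact Or.inr h
  · exact absurd hxP (Set.disjoint_left.1 h hxQ)

theorem IsNested.pairwiseDisjoint_maximalMembers {G : Finset (Set X)} (hG : IsNested G) :
    (maximalMembers G : Set (Set X)).PairwiseDisjoint id := by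
  intro Q hQ P hP hne
  have hQm := maximal_of_mem_maximalMembers hQ
  have hPm := maximal_of_mem_maximalMembers hP
  rcases hG Q hQm.prop P hPm.prop with h | h | h
  · exact absurd (hQm.eq_of_le hPm.prop h) hne
  · exact absurd (hPm.eq_of_le hQm.prop h).symm hne
  · exact h

open Classical in
/-- The members of `G` containing `x` form a chain, and those for which `x` is not `m`-deep are the
`m` smallest ones. -/
theorem IsNested.card_not_deep_le {G : Finset (Set X)} (hG : IsNested G) (m : ℕ) (x : X) :
    (G.filter fun Q => x ∈ Q \ deepPart G Q m).card ≤ m := by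
  have hlt : ∀ Q ∈ G, ∀ P, x ∈ Q → Q ⊂ P → (below G Q x).card < (below G P x).card := by
    intro Q hQ P hxQ hQP
    apply Finset.card_lt_card
    refine Finset.ssubset_iff_subset_ne.2 ⟨fun R hR => ?_, fun h => ?_⟩
    · rw [mem_below] at hR ⊢
      exact ⟨hR.1, hR.2.1, hR.2.2.trans hQP⟩
    · have : Q ∈ below G Q x := by
        rw [h, mem_below]; exact ⟨hQ, hxQ, hQP⟩
      exact (mem_below.1 this).2.2.ne rfl
  have := Finset.card_le_card_of_injOn (s := G.filter fun Q => x ∈ Q \ deepPart G Q m)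
    (t := Finset.range m) (fun Q => (below G Q x).card) ?_ ?_
  · simpa using this
  · intro Q hQ
    have hQ := (Finset.mem_filter.1 hQ).2
    by_contra h
    exact hQ.2 ⟨hQ.1, by simpa using h⟩
  · intro Q hQ P hP h
    have hQ := Finset.mem_filter.1 hQ
    have hP := Finset.mem_filter.1 hP
    by_contra hne
    rcases hG.subset_or hQ.1 hP.1 hQ.2.1 hP.2.1 with h' | h'
    · exact (hlt Q hQ.1 P hQ.2.1 (h'.ssubset_of_ne hne)).ne h
    · exact (hlt P hP.1 Q hP.2.1 (h'.ssubset_of_ne (Ne.symm hne))).ne h.symm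

open Classical in
theorem IsNested.deepPart_succ_subset {G : Finset (Set X)} (hG : IsNested G) (Q : Set X)
    (m : ℕ) :
    deepPart G Q (m + 1) ⊆ ⋃ P ∈ maximalMembers (G.filter (· ⊂ Q)), deepPart G P m := by
  rintro x ⟨-, hx⟩
  obtain ⟨P₀, hP₀⟩ := Finset.card_pos.1 (Nat.lt_of_lt_of_le (Nat.succ_pos m) hx)
  rw [mem_below] at hP₀
  obtain ⟨P, hP, hPP⟩ := exists_maximalMember (G := G.filter (· ⊂ Q)) (Q := P₀)
    (Finset.mem_filter.2 ⟨hP₀.1, hP₀.2.2⟩)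
  have hPm := maximal_of_mem_maximalMembers hP
  have hPG := Finset.mem_filter.1 hPm.prop
  refine Set.mem_biUnion hP ⟨hPP hP₀.2.1, ?_⟩
  have hsub : below G Q x ⊆ insert P (below G P x) := by
    intro R hR
    rw [mem_below] at hR
    rw [Finset.mem_insert, mem_below]
    by_cases hRP : R = P
    · exact Or.inl hRP
    right
    refine ⟨hR.1, hR.2.1, ?_⟩
    rcases hG.subset_or hR.1 hPG.1 hR.2.1 (hPP hP₀.2.1) with h | h
    · exact h.ssubset_of_ne hRP
    · exact absurd (hPm.eq_of_le (Finset.mem_filter.2 ⟨hR.1, hR.2.2⟩) h).symm hRP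
  have h1 := (Finset.card_le_card hsub).trans (Finset.card_insert_le _ _)
  omega

variable [MeasurableSpace X]

open Classical in
theorem measurableSet_deepPart {G : Finset (Set X)} (hG : ∀ Q ∈ G, MeasurableSet Q) {Q : Set X}
    (hQ : MeasurableSet Q) (m : ℕ) : MeasurableSet (deepPart G Q m) := by
  have hm : Measurable fun x => (below G Q x).card := by
    simp only [below, Finset.card_filter]
    refine Finset.measurable_sum _ fun P hP => ?_
    refine Measurable.ite ?_ measurable_const measurable_const
    by_cases h : P ⊂ Q
    · simpa [h] using hG P hP
    · simp [h]
  exact hQ.inter (hm measurableSet_Ici)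

/-- Every member of `G` is covered at most half by the members of `G` strictly inside it. -/
def IsHalfSparse (vol : Measure X) (G : Finset (Set X)) : Prop :=
  ∀ Q ∈ G, vol (⋃ P ∈ {P ∈ (G : Set (Set X)) | P ⊂ Q}, P) ≤ vol Q / 2

theorem IsHalfSparse.mono {vol : Measure X} {G H : Finset (Set X)} (hG : IsHalfSparse vol G)
    (h : H ⊆ G) : IsHalfSparse vol H := by
  intro Q hQ
  have hsub : {P ∈ (H : Set (Set X)) | P ⊂ Q} ⊆ {P ∈ (G : Set (Set X)) | P ⊂ Q} :=
    fun _ hP => ⟨h hP.1, hP.2⟩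
  exact (measure_mono (Set.biUnion_subset_biUnion_left hsub)).trans (hG Q (h hQ))

open Classical in
/-- In a sparse family the `m`-th generation inside `Q` has mass at most `2⁻ᵐ a |Q|`, for any
measure whose averages over the members of the family are at most `a`. -/
theorem measure_deepPart_le {vol μ : Measure X} {G : Finset (Set X)} (hn : IsNested G)
    (hm : ∀ Q ∈ G, MeasurableSet Q) (hs : IsHalfSparse vol G) {a : ℝ≥0∞}
    (ha : ∀ Q ∈ G, μ Q ≤ a * vol Q) (m : ℕ) :
    ∀ Q ∈ G, μ (deepPart G Q m) ≤ a * (2⁻¹ ^ m * vol Q) := by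
  induction m with
  | zero =>
    intro Q hQ
    have hsub : deepPart G Q 0 ⊆ Q := fun x hx => hx.1
    simpa using (measure_mono hsub).trans (ha Q hQ)
  | succ m ih =>
    intro Q hQ
    set H := G.filter (· ⊂ Q) with hH
    have hHG : H ⊆ G := Finset.filter_subset _ _
    have hMG : maximalMembers H ⊆ G := (maximalMembers_subset H).trans hHG
    calc μ (deepPart G Q (m + 1))
        ≤ μ (⋃ P ∈ maximalMembers H, deepPart G P m) := measure_mono (hn.deepPart_succ_subset Q m)
      _ ≤ ∑ P ∈ maximalMembers H, μ (deepPart G P m) := measure_biUnion_finset_le _ _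
      _ ≤ ∑ P ∈ maximalMembers H, a * (2⁻¹ ^ m * vol P) :=
          Finset.sum_le_sum fun P hP => ih P (hMG hP)
      _ = a * (2⁻¹ ^ m * vol (⋃ P ∈ maximalMembers H, P)) := by
          have := measure_biUnion_finset (μ := vol) (hn.mono hHG).pairwiseDisjoint_maximalMembers
            fun P hP => hm P (hMG hP)
          simp only [id] at this
          rw [← Finset.mul_sum, ← Finset.mul_sum, this]
      _ ≤ a * (2⁻¹ ^ m * (vol Q / 2)) := by
          gcongr
          refine (measure_mono (Set.biUnion_subset_biUnion_left fun P hP => ?_)).trans (hs Q hQ)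
          have := Finset.mem_filter.1 (maximalMembers_subset H hP)
          exact this
      _ = a * (2⁻¹ ^ (m + 1) * vol Q) := by
          rw [pow_succ, div_eq_mul_inv, mul_comm (vol Q), mul_assoc]

open Classical in
/-- Integrals over sets that overlap at most `m` times. The function `M` need not be measurable. -/
theorem sum_mul_lintegral_le {ν : Measure X} {g M : X → ℝ≥0∞} (hg : AEMeasurable g ν)
    {G : Finset (Set X)} {A : Set X → Set X} (hA : ∀ Q ∈ G, MeasurableSet (A Q)) {m : ℕ}
    (hcard : ∀ x, (G.filter fun Q => x ∈ A Q).card ≤ m) {c : Set X → ℝ≥0∞}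
    (hc : ∀ Q ∈ G, ∀ x ∈ A Q, c Q ≤ M x) :
    ∑ Q ∈ G, c Q * ∫⁻ x in A Q, g x ∂ν ≤ m * ∫⁻ x, g x * M x ∂ν := by
  calc ∑ Q ∈ G, c Q * ∫⁻ x in A Q, g x ∂ν
      = ∑ Q ∈ G, ∫⁻ x, c Q * (A Q).indicator g x ∂ν := by
        refine Finset.sum_congr rfl fun Q hQ => ?_
        rw [lintegral_const_mul'' _ (hg.indicator (hA Q hQ)), lintegral_indicator (hA Q hQ)]
    _ = ∫⁻ x, ∑ Q ∈ G, c Q * (A Q).indicator g x ∂ν :=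
        (lintegral_finsetSum' _ fun Q hQ => (hg.indicator (hA Q hQ)).const_mul _).symm
    _ ≤ ∫⁻ x, m * (g x * M x) ∂ν := by
        refine lintegral_mono fun x => ?_
        calc ∑ Q ∈ G, c Q * (A Q).indicator g x
            = ∑ Q ∈ G.filter fun Q => x ∈ A Q, c Q * g x := by
              rw [Finset.sum_filter]
              refine Finset.sum_congr rfl fun Q _ => ?_
              by_cases h : x ∈ A Q <;> simp [h]
          _ ≤ ∑ Q ∈ G.filter fun Q => x ∈ A Q, g x * M x := by
              refine Finset.sum_le_sum fun Q hQ => ?_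
              rw [mul_comm]
              gcongr
              exact hc Q (Finset.mem_filter.1 hQ).1 x (Finset.mem_filter.1 hQ).2
          _ ≤ m * (g x * M x) := by
              rw [Finset.sum_const, nsmul_eq_mul]
              gcongr
              exact_mod_cast hcard x
    _ = m * ∫⁻ x, g x * M x ∂ν := lintegral_const_mul' _ _ (ENNReal.natCast_ne_top m)

/-- The estimate for one layer of a sparse family, that is, for the members over which the average
of `g` is comparable to `a`. The hypothesis `hW` is the form in which a generalized Hölder
inequality for the weight enters. Each `Q` is cut into its `m`-deep part, which is so small that
`hW` gains the factor `δ`, and the rest, which overlaps at most `m` times. -/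
theorem layer_estimate {vol W : Measure X} {G : Finset (Set X)} (hn : IsNested G)
    (hm : ∀ Q ∈ G, MeasurableSet Q) (hfin : ∀ Q ∈ G, vol Q ≠ ∞) (hs : IsHalfSparse vol G)
    {g M : X → ℝ≥0∞} (hg : AEMeasurable g vol) {a δ : ℝ≥0∞} (ha : a ≠ ∞)
    (hup : ∀ Q ∈ G, ∫⁻ x in Q, g x ∂vol ≤ a * vol Q)
    (hlow : ∀ Q ∈ G, a * vol Q ≤ 4 * ∫⁻ x in Q, g x ∂vol)
    {N : Set X → ℝ≥0∞} (hN : ∀ Q ∈ G, ∀ x ∈ Q, N Q ≤ M x) {m : ℕ}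
    (hW : ∀ Q ∈ G, ∀ A ⊆ Q, MeasurableSet A → vol A ≤ 2⁻¹ ^ m * vol Q → W A ≤ δ * vol Q * N Q)
    (E : Set X) :
    a * ∑ Q ∈ G, W (E ∩ Q) ≤ a * m * W E + 32 * δ * ∫⁻ x, g x * M x ∂vol := by
  have hdm : ∀ k, ∀ Q ∈ G, MeasurableSet (deepPart G Q k) := fun k Q hQ =>
    measurableSet_deepPart hm (hm Q hQ) k
  have hdiff : ∀ k, ∀ Q ∈ G, MeasurableSet (Q \ deepPart G Q k) := fun k Q hQ =>
    (hm Q hQ).diff (hdm k Q hQ)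
  -- The part of `Q` outside its fourth generation carries a fixed portion of the integral of `g`.
  have hmass : ∀ Q ∈ G, a * vol Q ≤ 8 * ∫⁻ x in Q \ deepPart G Q 4, g x ∂vol := by
    intro Q hQ
    have hdeep := measure_deepPart_le (μ := vol.withDensity g) hn hm hs
      (fun P hP => by rw [withDensity_apply _ (hm P hP)]; exact hup P hP) 4 Q hQ
    rw [withDensity_apply _ (hdm 4 Q hQ)] at hdeep
    have hsplit : ∫⁻ x in Q, g x ∂vol ≤
        (∫⁻ x in Q \ deepPart G Q 4, g x ∂vol) + ∫⁻ x in deepPart G Q 4, g x ∂vol := by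
      refine (lintegral_mono_set ?_).trans (lintegral_union_le g _ _)
      rw [sdiff_union_self]
      exact subset_union_left
    have h1 : a * vol Q ≤
        4 * ((∫⁻ x in Q \ deepPart G Q 4, g x ∂vol) + 2⁻¹ ^ 4 * (a * vol Q)) :=
      (hlow Q hQ).trans (by
        gcongr
        refine hsplit.trans ?_
        gcongr
        rwa [mul_left_comm] at hdeep)
    have hb : a * vol Q ≠ ∞ := ENNReal.mul_ne_top ha (hfin Q hQ)
    generalize a * vol Q = b at h1 hb
    generalize (∫⁻ x in Q \ deepPart G Q 4, g x ∂vol) = I at h1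
    by_cases hI : I = ∞
    · simp [hI]
    lift b to NNReal using hb
    lift I to NNReal using hI
    have h2 : (2⁻¹ : ℝ≥0∞) = ((2⁻¹ : NNReal) : ℝ≥0∞) := by simp
    rw [h2] at h1
    have h3 : (b : NNReal) ≤ 4 * (I + 2⁻¹ ^ 4 * b) := by exact_mod_cast h1
    have h4 : b ≤ 8 * I := by
      rw [← NNReal.coe_le_coe] at h3 ⊢
      push_cast at h3 ⊢
      have := I.coe_nonneg
      linarith
    exact_mod_cast h4
  have hshallow : ∑ Q ∈ G, W (E ∩ (Q \ deepPart G Q m)) ≤ m * W E := by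
    have := sum_mul_lintegral_le (ν := W.restrict E) (g := fun _ => 1) (M := fun _ => 1)
      aemeasurable_const (A := fun Q => Q \ deepPart G Q m) (hdiff m)
      (fun x => by convert hn.card_not_deep_le m x) (c := fun _ => 1) (fun _ _ _ _ => le_rfl)
    simp only [mul_one, one_mul, lintegral_const, Measure.restrict_apply_univ] at this
    refine le_trans (Finset.sum_le_sum fun Q hQ => ?_) this
    rw [Measure.restrict_apply (hdiff m Q hQ), inter_comm]
  have hdeepW : a * ∑ Q ∈ G, W (deepPart G Q m) ≤ 32 * δ * ∫⁻ x, g x * M x ∂vol := by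
    calc a * ∑ Q ∈ G, W (deepPart G Q m)
        ≤ ∑ Q ∈ G, 8 * δ * (N Q * ∫⁻ x in Q \ deepPart G Q 4, g x ∂vol) := by
          rw [Finset.mul_sum]
          refine Finset.sum_le_sum fun Q hQ => ?_
          have hvol : vol (deepPart G Q m) ≤ 2⁻¹ ^ m * vol Q := by
            simpa using measure_deepPart_le (μ := vol) (a := 1) hn hm hs (by simp) m Q hQ
          calc a * W (deepPart G Q m) ≤ a * (δ * vol Q * N Q) := by
                gcongr
                exact hW Q hQ _ (fun x hx => hx.1) (hdm m Q hQ) hvol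
            _ = δ * N Q * (a * vol Q) := by ring
            _ ≤ δ * N Q * (8 * ∫⁻ x in Q \ deepPart G Q 4, g x ∂vol) := by
                gcongr δ * N Q * ?_; exact hmass Q hQ
            _ = _ := by ring
      _ = 8 * δ * ∑ Q ∈ G, N Q * ∫⁻ x in Q \ deepPart G Q 4, g x ∂vol := by
          rw [Finset.mul_sum]
      _ ≤ 8 * δ * ((4 : ℕ) * ∫⁻ x, g x * M x ∂vol) := by
          gcongr
          exact sum_mul_lintegral_le hg (hdiff 4)
            (fun x => by convert hn.card_not_deep_le 4 x) fun Q hQ x hx => hN Q hQ x hx.1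
      _ = _ := by push_cast; ring
  calc a * ∑ Q ∈ G, W (E ∩ Q)
      ≤ a * (∑ Q ∈ G, W (E ∩ (Q \ deepPart G Q m)) + ∑ Q ∈ G, W (deepPart G Q m)) := by
        rw [← Finset.sum_add_distrib]
        gcongr with Q hQ
        refine (measure_mono fun x hx => ?_).trans (measure_union_le _ _)
        by_cases h : x ∈ deepPart G Q m
        · exact Or.inr h
        · exact Or.inl ⟨hx.1, hx.2, h⟩
    _ ≤ a * (m * W E) + 32 * δ * ∫⁻ x, g x * M x ∂vol := by
        rw [mul_add]
        gcongr
    _ = _ := by rw [← mul_assoc a]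

end Families

/-! ### The weak-type estimate for finite sparse families -/

section FiniteFamilies

variable {X : Type*} [MeasurableSpace X]

theorem exists_layer {a : ℝ≥0∞} (h0 : a ≠ 0) (h : a ≤ 16⁻¹) :
    ∃ j : ℕ, a ≤ 16⁻¹ * 4⁻¹ ^ j ∧ 16⁻¹ * 4⁻¹ ^ j ≤ 4 * a := by
  have htop : a ≠ ∞ := ne_top_of_le_ne_top (by simp) h
  lift a to NNReal using htop
  have h16 : (16⁻¹ : ℝ≥0∞) = ((16⁻¹ : NNReal) : ℝ≥0∞) := by simp
  have h4 : (4⁻¹ : ℝ≥0∞) = ((4⁻¹ : NNReal) : ℝ≥0∞) := by simp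
  rw [h16] at h
  have h1 : a ≤ 16⁻¹ := by exact_mod_cast h
  have h0' : 0 < a := pos_iff_ne_zero.2 (by simpa using h0)
  obtain ⟨j, hj1, hj2⟩ := exists_nat_pow_near_of_lt_one (x := 16 * (a : ℝ)) (y := 4⁻¹)
    (by positivity) (by
      have : (a : ℝ) ≤ 16⁻¹ := by exact_mod_cast h1
      linarith) (by norm_num) (by norm_num)
  refine ⟨j, ?_, ?_⟩
  · rw [h16, h4]
    have : a ≤ 16⁻¹ * 4⁻¹ ^ j := by
      rw [← NNReal.coe_le_coe]; push_cast; linarith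
    exact_mod_cast this
  · rw [h16, h4]
    have : 16⁻¹ * 4⁻¹ ^ j ≤ 4 * a := by
      rw [← NNReal.coe_le_coe]; push_cast
      rw [pow_succ] at hj1; linarith
    exact_mod_cast this

/-- Absorption of a finite term into the left-hand side. -/
theorem le_two_mul_of_le_half_add {a b : ℝ≥0∞} (ha : a ≠ ∞) (h : a ≤ 2⁻¹ * a + b) :
    a ≤ 2 * b := by
  by_cases hb : b = ∞
  · simp [hb]
  lift a to NNReal using ha
  lift b to NNReal using hb
  have h2 : (2⁻¹ : ℝ≥0∞) = ((2⁻¹ : NNReal) : ℝ≥0∞) := by simp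
  rw [h2] at h
  have h3 : a ≤ 2⁻¹ * a + b := by exact_mod_cast h
  have h4 : a ≤ 2 * b := by
    rw [← NNReal.coe_le_coe] at h3 ⊢
    push_cast at h3 ⊢
    linarith
  exact_mod_cast h4

/-- The average `16⁻¹ 4⁻ʲ` of the `j`-th layer times the overlap `2ʲ⁺²` allowed there. -/
theorem layer_coefficient (j : ℕ) :
    (16⁻¹ * 4⁻¹ ^ j * ((2 ^ (j + 2) : ℕ) : ℝ≥0∞)) = 4⁻¹ * 2⁻¹ ^ j := by
  have h16 : (16⁻¹ : ℝ≥0∞) = ((16⁻¹ : NNReal) : ℝ≥0∞) := by simp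
  have h4 : (4⁻¹ : ℝ≥0∞) = ((4⁻¹ : NNReal) : ℝ≥0∞) := by simp
  have h2 : (2⁻¹ : ℝ≥0∞) = ((2⁻¹ : NNReal) : ℝ≥0∞) := by simp
  have key : (16⁻¹ * 4⁻¹ ^ j * ((2 ^ (j + 2) : ℕ) : NNReal)) = 4⁻¹ * 2⁻¹ ^ j := by
    have : (4⁻¹ : NNReal) ^ j = 2⁻¹ ^ j * 2⁻¹ ^ j := by
      rw [← mul_pow]; congr 1; rw [← mul_inv]; norm_num
    have h' : (2⁻¹ : NNReal) ^ j * 2 ^ j = 1 := by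
      rw [← mul_pow]; simp
    push_cast
    rw [this, pow_add]
    calc (16⁻¹ * (2⁻¹ ^ j * 2⁻¹ ^ j) * (2 ^ j * 2 ^ 2) : NNReal)
        = 16⁻¹ * 2 ^ 2 * 2⁻¹ ^ j * (2⁻¹ ^ j * 2 ^ j) := by ring
      _ = _ := by rw [h']; norm_num
  rw [h16, h4, h2]
  exact_mod_cast key

open Classical in
/-- The maximal function estimate: the members of `F` with large averages have small union. -/
theorem measure_large_averages_le {vol W : Measure X} {F : Finset (Set X)} (hn : IsNested F)
    (hm : ∀ Q ∈ F, MeasurableSet Q) (h0 : ∀ Q ∈ F, vol Q ≠ 0) (hfin : ∀ Q ∈ F, vol Q ≠ ∞)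
    {g M : X → ℝ≥0∞} (hg : AEMeasurable g vol) (hlarge : ∀ Q ∈ F, 16⁻¹ < ⨍⁻ x in Q, g x ∂vol)
    {N : Set X → ℝ≥0∞} (hN : ∀ Q ∈ F, ∀ x ∈ Q, N Q ≤ M x)
    (hW : ∀ Q ∈ F, W Q ≤ 2 * vol Q * N Q) :
    W (⋃ Q ∈ F, Q) ≤ 32 * ∫⁻ x, g x * M x ∂vol := by
  have hsub := maximalMembers_subset F
  calc W (⋃ Q ∈ F, Q) ≤ W (⋃ Q ∈ maximalMembers F, Q) := by
        refine measure_mono (iUnion₂_subset fun Q hQ => ?_)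
        obtain ⟨P, hP, hQP⟩ := exists_maximalMember hQ
        exact hQP.trans (subset_biUnion_of_mem (u := id) hP)
    _ ≤ ∑ Q ∈ maximalMembers F, W Q := measure_biUnion_finset_le _ _
    _ ≤ ∑ Q ∈ maximalMembers F, 32 * (N Q * ∫⁻ x in Q, g x ∂vol) := by
        refine Finset.sum_le_sum fun Q hQ => (hW Q (hsub hQ)).trans ?_
        have h1 := (hlarge Q (hsub hQ)).le
        rw [setLAverage_eq, ENNReal.le_div_iff_mul_le (Or.inl (h0 Q (hsub hQ)))
          (Or.inl (hfin Q (hsub hQ)))] at h1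
        have h2 : vol Q ≤ 16 * ∫⁻ x in Q, g x ∂vol := by
          calc vol Q = 16 * (16⁻¹ * vol Q) := by
                rw [← mul_assoc, ENNReal.mul_inv_cancel (by simp) (by simp), one_mul]
            _ ≤ _ := by gcongr
        calc 2 * vol Q * N Q ≤ 2 * (16 * ∫⁻ x in Q, g x ∂vol) * N Q := by gcongr 2 * ?_ * _
          _ = _ := by ring
    _ = 32 * ∑ Q ∈ maximalMembers F, N Q * ∫⁻ x in Q, g x ∂vol := by rw [Finset.mul_sum]
    _ ≤ 32 * ((1 : ℕ) * ∫⁻ x, g x * M x ∂vol) := by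
        gcongr
        refine sum_mul_lintegral_le hg (A := id) (fun Q hQ => hm Q (hsub hQ)) (fun x => ?_)
          fun Q hQ => hN Q (hsub hQ)
        refine Finset.card_le_one.2 fun Q hQ P hP => ?_
        rw [Finset.mem_filter] at hQ hP
        by_contra hne
        exact Set.disjoint_left.1 (hn.pairwiseDisjoint_maximalMembers hQ.1 hP.1 hne) hQ.2 hP.2
    _ = _ := by simp

open Classical in
/-- The weak-type estimate at height one for a finite sparse family. The hypotheses on `W` hold for
a weight whose generalized Hölder inequality gains `r ^ j` on sets of relative measure
`2 ^ (-2 ^ (j + 2))`. -/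
theorem finite_weak_estimate {vol W : Measure X} {F : Finset (Set X)} (hn : IsNested F)
    (hm : ∀ Q ∈ F, MeasurableSet Q) (h0 : ∀ Q ∈ F, vol Q ≠ 0) (hfin : ∀ Q ∈ F, vol Q ≠ ∞)
    (hs : IsHalfSparse vol F) (hWfin : ∀ Q ∈ F, W Q ≠ ∞)
    {g M : X → ℝ≥0∞} (hg : AEMeasurable g vol)
    {N : Set X → ℝ≥0∞} (hN : ∀ Q ∈ F, ∀ x ∈ Q, N Q ≤ M x)
    (hW : ∀ Q ∈ F, W Q ≤ 2 * vol Q * N Q) {r : ℝ≥0∞}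
    (hWr : ∀ j : ℕ, ∀ Q ∈ F, ∀ A ⊆ Q, MeasurableSet A → vol A ≤ 2⁻¹ ^ (2 ^ (j + 2)) * vol Q →
      W A ≤ 2 * r ^ j * vol Q * N Q) :
    W {x | 1 < ∑ Q ∈ F, Q.indicator (fun _ => ⨍⁻ y in Q, g y ∂vol) x} ≤
      (32 + 128 * (1 - r)⁻¹) * ∫⁻ x, g x * M x ∂vol := by
  set I := ∫⁻ x, g x * M x ∂vol with hI
  set av : Set X → ℝ≥0∞ := fun Q => ⨍⁻ y in Q, g y ∂vol with hav
  set Ω := ⋃ Q ∈ F.filter (fun Q => 16⁻¹ < av Q), Q with hΩ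
  have hmul : ∀ Q ∈ F, av Q * vol Q = ∫⁻ x in Q, g x ∂vol := fun Q hQ => by
    rw [hav]; simp only
    rw [setLAverage_eq, ENNReal.div_mul_cancel (h0 Q hQ) (hfin Q hQ)]
  have hΩm : MeasurableSet Ω :=
    Finset.measurableSet_biUnion _ fun Q hQ => hm Q (Finset.mem_filter.1 hQ).1
  have hTm : Measurable fun x => ∑ Q ∈ F, Q.indicator (fun _ => av Q) x :=
    Finset.measurable_sum _ fun Q hQ => measurable_const.indicator (hm Q hQ)
  set E := {x | 1 < ∑ Q ∈ F, Q.indicator (fun _ => av Q) x} \ Ω with hE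
  have hEm : MeasurableSet E := (measurableSet_lt measurable_const hTm).diff hΩm
  have hEfin : W E ≠ ∞ := by
    have hsub : E ⊆ ⋃ Q ∈ F, Q := by
      intro x hx
      by_contra hne
      have hz : ∑ Q ∈ F, Q.indicator (fun _ => av Q) x = 0 :=
        Finset.sum_eq_zero fun Q hQ => indicator_of_notMem
          (fun hxQ => hne (mem_biUnion hQ hxQ)) _
      have h1 : 1 < ∑ Q ∈ F, Q.indicator (fun _ => av Q) x := hx.1
      rw [hz] at h1
      exact absurd h1 (by simp)
    refine ne_top_of_le_ne_top ?_ ((measure_mono hsub).trans (measure_biUnion_finset_le _ _))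
    exact (ENNReal.sum_lt_top.2 fun Q hQ => (hWfin Q hQ).lt_top).ne
  set G : ℕ → Finset (Set X) := fun j =>
    F.filter fun Q => av Q ≤ 16⁻¹ * 4⁻¹ ^ j ∧ 16⁻¹ * 4⁻¹ ^ j ≤ 4 * av Q with hG
  have hGF : ∀ j, G j ⊆ F := fun j => Finset.filter_subset _ _
  have hlayers : W E ≤ ∑' j, 16⁻¹ * 4⁻¹ ^ j * ∑ Q ∈ G j, W (E ∩ Q) := by
    calc W E = ∫⁻ _ in E, 1 ∂W := by simp
      _ ≤ ∫⁻ x in E, ∑ Q ∈ F, Q.indicator (fun _ => av Q) x ∂W :=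
          setLIntegral_mono' hEm fun x hx => hx.1.le
      _ = ∑ Q ∈ F, av Q * W (E ∩ Q) := by
          rw [lintegral_finsetSum _ fun Q hQ => measurable_const.indicator (hm Q hQ)]
          refine Finset.sum_congr rfl fun Q hQ => ?_
          rw [lintegral_indicator_const (hm Q hQ), Measure.restrict_apply (hm Q hQ), inter_comm]
      _ ≤ ∑ Q ∈ F, ∑' j, if Q ∈ G j then 16⁻¹ * 4⁻¹ ^ j * W (E ∩ Q) else 0 := by
          refine Finset.sum_le_sum fun Q hQ => ?_
          by_cases hz : av Q = 0
          · simp [hz]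
          by_cases hl : 16⁻¹ < av Q
          · have : E ∩ Q = ∅ := by
              refine eq_empty_of_forall_notMem fun x hx => hx.1.2 ?_
              exact mem_biUnion (Finset.mem_filter.2 ⟨hQ, hl⟩) hx.2
            simp [this]
          obtain ⟨j, hj⟩ := exists_layer hz (not_lt.1 hl)
          refine le_trans ?_ (ENNReal.le_tsum j)
          rw [if_pos (Finset.mem_filter.2 ⟨hQ, hj⟩)]
          gcongr
          exact hj.1
      _ = ∑' j, ∑ Q ∈ F, if Q ∈ G j then 16⁻¹ * 4⁻¹ ^ j * W (E ∩ Q) else 0 :=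
          (Summable.tsum_finsetSum fun _ _ => ENNReal.summable).symm
      _ = _ := by
          refine tsum_congr fun j => ?_
          rw [← Finset.sum_filter, Finset.mul_sum, Finset.filter_mem_eq_inter,
            Finset.inter_eq_right.2 (hGF j)]
  have hone : ∀ j, 16⁻¹ * 4⁻¹ ^ j * ∑ Q ∈ G j, W (E ∩ Q) ≤
      4⁻¹ * 2⁻¹ ^ j * W E + 64 * r ^ j * I := by
    intro j
    have hj := layer_estimate (hn.mono (hGF j)) (fun Q hQ => hm Q (hGF j hQ))
      (fun Q hQ => hfin Q (hGF j hQ)) (hs.mono (hGF j)) hg (a := 16⁻¹ * 4⁻¹ ^ j)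
      (δ := 2 * r ^ j) (ENNReal.mul_ne_top (by simp) (ENNReal.pow_ne_top (by simp)))
      (fun Q hQ => by
        rw [← hmul Q (hGF j hQ)]
        gcongr
        exact (Finset.mem_filter.1 hQ).2.1)
      (fun Q hQ => by
        rw [← hmul Q (hGF j hQ), ← mul_assoc]
        gcongr ?_ * _
        exact (Finset.mem_filter.1 hQ).2.2)
      (fun Q hQ => hN Q (hGF j hQ)) (fun Q hQ => hWr j Q (hGF j hQ)) E
    rw [layer_coefficient] at hj
    refine hj.trans_eq ?_
    rw [← hI]; ring
  have hWE : W E ≤ 2 * (64 * (1 - r)⁻¹ * I) := by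
    refine le_two_mul_of_le_half_add hEfin (hlayers.trans ((ENNReal.tsum_le_tsum hone).trans_eq ?_))
    rw [ENNReal.tsum_add, ENNReal.tsum_mul_right, ENNReal.tsum_mul_right, ENNReal.tsum_mul_left,
      ENNReal.tsum_mul_left, ENNReal.tsum_geometric, ENNReal.tsum_geometric]
    congr 2
    rw [ENNReal.one_sub_inv_two, inv_inv]
    have h4 : (4 : ℝ≥0∞) = 2 * 2 := by norm_num
    rw [h4, ENNReal.mul_inv (by simp) (by simp), mul_assoc,
      ENNReal.inv_mul_cancel (by simp) (by simp), mul_one]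
  have hWΩ : W Ω ≤ 32 * I := by
    have hsub : F.filter (fun Q => 16⁻¹ < av Q) ⊆ F := Finset.filter_subset _ _
    exact measure_large_averages_le (hn.mono hsub) (fun Q hQ => hm Q (hsub hQ))
      (fun Q hQ => h0 Q (hsub hQ)) (fun Q hQ => hfin Q (hsub hQ)) hg
      (fun Q hQ => (Finset.mem_filter.1 hQ).2) (fun Q hQ => hN Q (hsub hQ))
      fun Q hQ => hW Q (hsub hQ)
  calc W {x | 1 < ∑ Q ∈ F, Q.indicator (fun _ => av Q) x}
      ≤ W (Ω ∪ E) := measure_mono fun x hx => by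
        by_cases h : x ∈ Ω
        · exact Or.inl h
        · exact Or.inr ⟨hx, h⟩
    _ ≤ W Ω + W E := measure_union_le _ _
    _ ≤ 32 * I + 2 * (64 * (1 - r)⁻¹ * I) := add_le_add hWΩ hWE
    _ = _ := by ring

end FiniteFamilies

/-! ### The generalized Hölder inequality for `L (log L)^ε` -/

section Orlicz

theorem youngLLogL_nonneg {ε t : ℝ} (ht : 0 ≤ t) : 0 ≤ youngLLogL ε t :=
  mul_nonneg ht (Real.rpow_nonneg (by linarith [Real.posLog_nonneg (x := t)]) _)

/-- A Young-type inequality for `t (1 + log⁺ t) ^ ε`: split according to whether `s ≤ eˣ`. -/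
theorem le_exp_add_mul_youngLLogL {ε s x : ℝ} (hε : 0 ≤ ε) (hs : 0 ≤ s) (hx : 0 ≤ x) :
    s ≤ Real.exp x + (1 + x) ^ (-ε) * youngLLogL ε s := by
  rcases le_or_gt s (Real.exp x) with h | h
  · have := mul_nonneg (Real.rpow_nonneg (by linarith : 0 ≤ 1 + x) (-ε))
      (youngLLogL_nonneg (ε := ε) hs)
    linarith
  · have hlog : x ≤ Real.posLog s :=
      ((Real.le_log_iff_exp_le ((Real.exp_pos x).trans h)).2 h.le).trans
        (by rw [Real.posLog_def]; exact le_max_right _ _)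
    have h1 : (1 + x) ^ ε ≤ (1 + Real.posLog s) ^ ε :=
      Real.rpow_le_rpow (by linarith) (by linarith) hε
    have hp : 0 < (1 + x) ^ ε := Real.rpow_pos_of_pos (by linarith) _
    have h2 : s ≤ (1 + x) ^ (-ε) * youngLLogL ε s := by
      rw [Real.rpow_neg (by linarith), youngLLogL, ← div_eq_inv_mul, le_div_iff₀ hp]
      exact mul_le_mul_of_nonneg_left h1 hs
    linarith [Real.exp_pos x]

variable {n : ℕ}

/-- The generalized Hölder inequality for `L (log L) ^ ε`, tested on the indicator of a set of
relative measure at most `e^(-2x)`. -/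
theorem weightMeasure_le_luxemburgNorm {ε : ℝ} (hε : 0 < ε) (hε1 : ε ≤ 1)
    {w : (Fin n → ℝ) → ℝ} (hw : ∀ x, 0 ≤ w x) {Q A : Set (Fin n → ℝ)} (h0 : volume Q ≠ 0)
    (hfin : volume Q ≠ ∞) (hAQ : A ⊆ Q) (hA : MeasurableSet A) {x : ℝ} (hx : 0 ≤ x)
    (hvol : volume A ≤ ENNReal.ofReal (Real.exp (-(2 * x))) * volume Q) :
    weightMeasure w A ≤ 2 * ENNReal.ofReal ((1 + x) ^ (-ε)) * volume Q *
      luxemburgNorm (youngLLogL ε) Q w := by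
  set θ := (1 + x) ^ (-ε) with hθ
  have hθ0 : 0 < θ := Real.rpow_pos_of_pos (by linarith) _
  have hexp : Real.exp (-x) ≤ θ := by
    rw [hθ, Real.rpow_neg (by linarith), Real.exp_neg]
    refine inv_anti₀ (Real.rpow_pos_of_pos (by linarith) _) ?_
    calc (1 + x) ^ ε ≤ (1 + x) ^ (1 : ℝ) := Real.rpow_le_rpow_of_exponent_le (by linarith) hε1
      _ = x + 1 := by rw [Real.rpow_one, add_comm]
      _ ≤ Real.exp x := Real.add_one_le_exp x
  have hK0 : 2 * ENNReal.ofReal θ * volume Q ≠ 0 := by simp [h0, hθ0]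
  have hKt : 2 * ENNReal.ofReal θ * volume Q ≠ ∞ :=
    ENNReal.mul_ne_top (ENNReal.mul_ne_top (by simp) (by simp)) hfin
  rw [weightMeasure, withDensity_apply _ hA, mul_comm,
    ← ENNReal.div_le_iff hK0 hKt, luxemburgNorm]
  refine le_iInf fun t => le_iInf fun ht => le_iInf fun hav => ?_
  rw [ENNReal.div_le_iff hK0 hKt]
  rw [setLAverage_eq, ENNReal.div_le_iff h0 hfin, one_mul] at hav
  calc ∫⁻ y in A, ENNReal.ofReal (w y)
      ≤ ∫⁻ y in A, (ENNReal.ofReal (t * Real.exp x) +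
          ENNReal.ofReal (t * θ) * ENNReal.ofReal (youngLLogL ε (|w y| / t))) := by
        refine lintegral_mono fun y => ?_
        rw [← ENNReal.ofReal_mul (by positivity), ← ENNReal.ofReal_add (by positivity)
          (mul_nonneg (by positivity) (youngLLogL_nonneg (by positivity)))]
        refine ENNReal.ofReal_le_ofReal ?_
        have := mul_le_mul_of_nonneg_left
          (le_exp_add_mul_youngLLogL (s := |w y| / t) hε.le (by positivity) hx) ht.le
        rw [mul_div_cancel₀ _ ht.ne', abs_of_nonneg (hw y)] at this
        rw [abs_of_nonneg (hw y)]
        linarith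
    _ = ENNReal.ofReal (t * Real.exp x) * volume A +
          ENNReal.ofReal (t * θ) * ∫⁻ y in A, ENNReal.ofReal (youngLLogL ε (|w y| / t)) := by
        rw [lintegral_add_left measurable_const, lintegral_const_mul' _ _ ENNReal.ofReal_ne_top]
        simp
    _ ≤ ENNReal.ofReal (t * Real.exp x) * (ENNReal.ofReal (Real.exp (-(2 * x))) * volume Q) +
          ENNReal.ofReal (t * θ) * volume Q := by
        gcongr
        exact (lintegral_mono_set hAQ).trans hav
    _ = (ENNReal.ofReal (t * Real.exp (-x)) + ENNReal.ofReal (t * θ)) * volume Q := by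
        rw [← mul_assoc, ← ENNReal.ofReal_mul (by positivity), ← add_mul, mul_assoc,
          ← Real.exp_add]
        ring_nf
    _ ≤ (ENNReal.ofReal (t * θ) + ENNReal.ofReal (t * θ)) * volume Q := by gcongr
    _ = ENNReal.ofReal t * (2 * ENNReal.ofReal θ * volume Q) := by
        rw [ENNReal.ofReal_mul ht.le]; ring

/-- The generalized Hölder inequality on sets of relative measure at most `2 ^ (-2 ^ (j + 2))`. -/
theorem weightMeasure_le_of_volume_le_two_pow {ε : ℝ} (hε : 0 < ε) (hε1 : ε ≤ 1)
    {w : (Fin n → ℝ) → ℝ} (hw : ∀ x, 0 ≤ w x) {Q A : Set (Fin n → ℝ)} (h0 : volume Q ≠ 0)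
    (hfin : volume Q ≠ ∞) (hAQ : A ⊆ Q) (hA : MeasurableSet A) (j : ℕ)
    (hvol : volume A ≤ 2⁻¹ ^ (2 ^ (j + 2)) * volume Q) :
    weightMeasure w A ≤ 2 * ENNReal.ofReal (2 ^ (-ε)) ^ j * volume Q *
      luxemburgNorm (youngLLogL ε) Q w := by
  -- The exponent `x` is chosen so that `e^(-2x) = 2 ^ (-2 ^ (j + 2))`.
  set x : ℝ := 2 ^ (j + 1) * Real.log 2 with hx
  have hx0 : 0 ≤ x := by positivity
  have hexp : ENNReal.ofReal (Real.exp (-(2 * x))) = 2⁻¹ ^ (2 ^ (j + 2)) := by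
    have : Real.exp (-(2 * x)) = 2⁻¹ ^ (2 ^ (j + 2)) := by
      have h : -(2 * x) = ((2 ^ (j + 2) : ℕ) : ℝ) * -Real.log 2 := by
        rw [hx]; push_cast; ring
      rw [h, Real.exp_nat_mul, Real.exp_neg, Real.exp_log (by norm_num)]
    rw [this, ENNReal.ofReal_pow (by norm_num), ENNReal.ofReal_inv_of_pos (by norm_num)]
    simp
  refine (weightMeasure_le_luxemburgNorm hε hε1 hw h0 hfin hAQ hA hx0 (by rwa [hexp])).trans ?_
  gcongr
  rw [← ENNReal.ofReal_pow (by positivity)]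
  refine ENNReal.ofReal_le_ofReal ?_
  have h1 : (2 : ℝ) ^ j ≤ 1 + x := by
    have : (1 / 2 : ℝ) ≤ Real.log 2 := by linarith [Real.log_two_gt_d9]
    have h2 : (0 : ℝ) < 2 ^ j := by positivity
    rw [hx, pow_succ]
    nlinarith
  calc (1 + x) ^ (-ε) ≤ ((2 : ℝ) ^ j) ^ (-ε) :=
        Real.rpow_le_rpow_of_nonpos (by positivity) h1 (by linarith)
    _ = ((2 : ℝ) ^ (-ε)) ^ j := by
        rw [← Real.rpow_natCast, ← Real.rpow_natCast, ← Real.rpow_mul (by norm_num),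
          ← Real.rpow_mul (by norm_num), mul_comm]

/-- The geometric series with ratio `2⁻ᵋ` is the source of the factor `1 / ε`. -/
theorem inv_one_sub_two_rpow_neg_le {ε : ℝ} (hε : 0 < ε) (hε1 : ε ≤ 1) :
    (1 - ENNReal.ofReal (2 ^ (-ε)))⁻¹ ≤ ENNReal.ofReal (2 / ε) := by
  have h : (2 : ℝ) ^ (-ε) ≤ 1 - ε / 2 := by
    have := rpow_one_add_le_one_add_mul_self (s := -1 / 2) (by norm_num) hε.le hε1
    rw [Real.rpow_neg (by norm_num), ← Real.inv_rpow (by norm_num)]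
    norm_num at this ⊢
    linarith
  have h2 : ENNReal.ofReal (ε / 2) ≤ 1 - ENNReal.ofReal (2 ^ (-ε)) := by
    rw [← ENNReal.ofReal_one, ← ENNReal.ofReal_sub _ (by positivity)]
    exact ENNReal.ofReal_le_ofReal (by linarith)
  rw [← inv_div ε 2, ENNReal.ofReal_inv_of_pos (by positivity)]
  exact ENNReal.inv_le_inv.2 h2

end Orlicz

/-! ### Cubes and dyadic grids -/

section Cubes

variable {n : ℕ}

theorem IsCube.measurableSet {Q : Set (Fin n → ℝ)} (hQ : IsCube Q) : MeasurableSet Q := by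
  obtain ⟨a, l, -, rfl⟩ := hQ
  exact MeasurableSet.univ_pi fun i => measurableSet_Ico

theorem IsCube.interior_nonempty {Q : Set (Fin n → ℝ)} (hQ : IsCube Q) :
    (interior Q).Nonempty := by
  obtain ⟨a, l, hl, rfl⟩ := hQ
  rw [interior_pi_set finite_univ]
  refine univ_pi_nonempty_iff.2 fun i => ?_
  rw [interior_Ico]
  exact nonempty_Ioo.2 (by linarith)

theorem IsCube.volume_ne_zero {Q : Set (Fin n → ℝ)} (hQ : IsCube Q) : volume Q ≠ 0 :=
  (Measure.measure_pos_of_nonempty_interior _ hQ.interior_nonempty).ne'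

theorem IsCube.exists_isCompact_superset {Q : Set (Fin n → ℝ)} (hQ : IsCube Q) :
    ∃ K, IsCompact K ∧ Q ⊆ K := by
  obtain ⟨a, l, -, rfl⟩ := hQ
  exact ⟨Set.univ.pi fun i => Icc (a i) (a i + l), isCompact_univ_pi fun i => isCompact_Icc,
    pi_mono fun i _ => Ico_subset_Icc_self⟩

theorem IsCube.volume_ne_top {Q : Set (Fin n → ℝ)} (hQ : IsCube Q) : volume Q ≠ ∞ := by
  obtain ⟨K, hK, hQK⟩ := hQ.exists_isCompact_superset
  exact ne_top_of_le_ne_top hK.measure_ne_top (measure_mono hQK)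

theorem IsCube.weightMeasure_ne_top {Q : Set (Fin n → ℝ)} (hQ : IsCube Q) {w : (Fin n → ℝ) → ℝ}
    (hw : LocallyIntegrable w volume) : weightMeasure w Q ≠ ∞ := by
  obtain ⟨K, hK, hQK⟩ := hQ.exists_isCompact_superset
  have hint : IntegrableOn w Q volume := (hw.integrableOn_isCompact hK).mono_set hQK
  rw [weightMeasure, withDensity_apply _ hQ.measurableSet]
  refine ne_top_of_le_ne_top hint.2.ne (lintegral_mono fun x => ?_)
  exact Real.ofReal_le_enorm (w x)

theorem IsDyadicGrid.countable {D : Set (Set (Fin n → ℝ))} (hD : IsDyadicGrid D) :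
    D.Countable := by
  have hsub : D ⊆ ⋃ k : ℤ, {Q ∈ D | volume Q = (2 : ℝ≥0∞) ^ ((n : ℤ) * k)} := fun Q hQ => by
    obtain ⟨k, hk⟩ := hD.volume_eq Q hQ
    exact mem_iUnion.2 ⟨k, hQ, hk⟩
  refine (countable_iUnion fun k => ?_).mono hsub
  exact (hD.partition k).pairwiseDisjoint.countable_of_nonempty_interior fun Q hQ =>
    (hD.isCube Q hQ.1).interior_nonempty

theorem IsDyadicGrid.isNested {D : Set (Set (Fin n → ℝ))} (hD : IsDyadicGrid D)
    {F : Finset (Set (Fin n → ℝ))} (hF : (F : Set (Set (Fin n → ℝ))) ⊆ D) : IsNested F := by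
  intro Q hQ P hP
  rcases hD.nested Q (hF hQ) P (hF hP) with h | h | h
  · exact Or.inr (Or.inr (disjoint_iff_inter_eq_empty.2 h))
  · exact Or.inr (Or.inl (inter_eq_right.1 h))
  · exact Or.inl (inter_eq_left.1 h)

theorem IsSparse.isHalfSparse {S : Set (Set (Fin n → ℝ))} (hS : IsSparse S)
    {F : Finset (Set (Fin n → ℝ))} (hF : (F : Set (Set (Fin n → ℝ))) ⊆ S) :
    IsHalfSparse volume F := by
  intro Q hQ
  have hsub : {P ∈ (F : Set (Set (Fin n → ℝ))) | P ⊂ Q} ⊆ {Q' ∈ S | Q' ⊂ Q} :=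
    fun P hP => ⟨hF hP.1, hP.2⟩
  exact (measure_mono (biUnion_subset_biUnion_left hsub)).trans (hS Q (hF hQ))

end Cubes

/-! ### Sparse operators -/

section SparseOperator

variable {n : ℕ}

/-- The sparse operator applied to `|f|`, with values in `[0, ∞]`; it dominates the sparse operator
whether or not the series defining the latter converges. -/
noncomputable def absSparseOp (S : Set (Set (Fin n → ℝ))) (f : (Fin n → ℝ) → ℂ)
    (x : Fin n → ℝ) : ℝ≥0∞ :=
  ∑' Q : S, (Q : Set (Fin n → ℝ)).indicator
    (fun _ => ⨍⁻ y in (Q : Set (Fin n → ℝ)), ‖f y‖ₑ ∂volume) x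

theorem enorm_sparseTerm_le (f : (Fin n → ℝ) → ℂ) (x : Fin n → ℝ) (Q : Set (Fin n → ℝ)) :
    ‖sparseTerm f x Q‖ₑ ≤ Q.indicator (fun _ => ⨍⁻ y in Q, ‖f y‖ₑ ∂volume) x := by
  by_cases h : x ∈ Q
  · simp only [sparseTerm, indicator_of_mem h]
    exact enorm_integral_le_lintegral_enorm _
  · simp [sparseTerm, h]

theorem enorm_sparseOp_le (S : Set (Set (Fin n → ℝ))) (f : (Fin n → ℝ) → ℂ) (x : Fin n → ℝ) :
    ‖sparseOp S f x‖ₑ ≤ absSparseOp S f x :=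
  enorm_tsum_le_tsum_enorm.trans (ENNReal.tsum_le_tsum fun Q => enorm_sparseTerm_le f x Q)

theorem summable_sparseTerm {S : Set (Set (Fin n → ℝ))} {f : (Fin n → ℝ) → ℂ} {x : Fin n → ℝ}
    (h : absSparseOp S f x ≠ ∞) : Summable fun Q : S => sparseTerm f x (Q : Set (Fin n → ℝ)) := by
  refine Summable.of_enorm (ne_top_of_le_ne_top h ?_)
  exact ENNReal.tsum_le_tsum fun Q => enorm_sparseTerm_le f x Q

theorem setLAverage_const_mul {c : ℝ≥0∞} (hc : c ≠ ∞) (g : (Fin n → ℝ) → ℝ≥0∞)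
    (Q : Set (Fin n → ℝ)) : ⨍⁻ y in Q, c * g y ∂volume = c * ⨍⁻ y in Q, g y ∂volume := by
  rw [setLAverage_eq, setLAverage_eq, lintegral_const_mul' _ _ hc, mul_div_assoc]

/-- The weak-type estimate for `absSparseOp`, obtained from that for finite subfamilies by
monotone convergence. -/
theorem mul_weightMeasure_absSparseOp_le {D S : Set (Set (Fin n → ℝ))} (hD : IsDyadicGrid D)
    (hSD : S ⊆ D) (hS : IsSparse S) {ε : ℝ} (hε : 0 < ε) (hε1 : ε ≤ 1) {w : (Fin n → ℝ) → ℝ}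
    (hw : ∀ x, 0 ≤ w x) (hwi : LocallyIntegrable w volume) {f : (Fin n → ℝ) → ℂ}
    (hf : LocallyIntegrable f volume) {t : ℝ} (ht : 0 < t) :
    ENNReal.ofReal t * weightMeasure w {x | ENNReal.ofReal t < absSparseOp S f x} ≤
      ENNReal.ofReal (288 / ε) * ∫⁻ x, ‖f x‖ₑ * orliczMaximal (youngLLogL ε) w x := by
  have : Countable S := (hD.countable.mono hSD).to_subtype
  set c := ENNReal.ofReal t with hc
  have hc0 : c ≠ 0 := by simpa [hc] using ht
  have hct : c ≠ ∞ := ENNReal.ofReal_ne_top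
  set I := ∫⁻ x, ‖f x‖ₑ * orliczMaximal (youngLLogL ε) w x with hI
  set h : S → (Fin n → ℝ) → ℝ≥0∞ := fun Q x =>
    (Q : Set (Fin n → ℝ)).indicator
      (fun _ => ⨍⁻ y in (Q : Set (Fin n → ℝ)), ‖f y‖ₑ ∂volume) x with hh
  have hfinite : ∀ F : Finset S, weightMeasure w {x | c < ∑ Q ∈ F, h Q x} ≤
      ENNReal.ofReal (288 / ε) * (c⁻¹ * I) := by
    intro F
    set F' : Finset (Set (Fin n → ℝ)) := F.map (Function.Embedding.subtype _) with hF'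
    have hF'S : (F' : Set (Set (Fin n → ℝ))) ⊆ S := by
      intro Q hQ
      obtain ⟨P, -, rfl⟩ := Finset.mem_map.1 hQ
      exact P.2
    have hcube : ∀ Q ∈ F', IsCube Q := fun Q hQ => hD.isCube Q (hSD (hF'S hQ))
    have hset : {x | c < ∑ Q ∈ F, h Q x} = {x | 1 < ∑ Q ∈ F',
        Q.indicator (fun _ => ⨍⁻ y in Q, c⁻¹ * ‖f y‖ₑ ∂volume) x} := by
      ext x
      have hsum : ∑ Q ∈ F', Q.indicator (fun _ => ⨍⁻ y in Q, c⁻¹ * ‖f y‖ₑ ∂volume) x =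
          (∑ Q ∈ F, h Q x) / c := by
        rw [hF', Finset.sum_map, div_eq_mul_inv, mul_comm, Finset.mul_sum]
        refine Finset.sum_congr rfl fun Q _ => ?_
        rw [hh]
        by_cases hx : x ∈ (Q : Set (Fin n → ℝ))
        · simp [hx, setLAverage_const_mul (ENNReal.inv_ne_top.2 hc0)]
        · simp [hx]
      rw [mem_ofPred_eq, mem_ofPred_eq, hsum,
        ENNReal.lt_div_iff_mul_lt (Or.inl hc0) (Or.inl hct), one_mul]
    rw [hset]
    refine (finite_weak_estimate (vol := volume) (hD.isNested (hF'S.trans hSD))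
      (fun Q hQ => (hcube Q hQ).measurableSet) (fun Q hQ => (hcube Q hQ).volume_ne_zero)
      (fun Q hQ => (hcube Q hQ).volume_ne_top) (hS.isHalfSparse hF'S)
      (fun Q hQ => (hcube Q hQ).weightMeasure_ne_top hwi)
      (M := orliczMaximal (youngLLogL ε) w) (N := fun Q => luxemburgNorm (youngLLogL ε) Q w)
      (hf.aestronglyMeasurable.enorm.const_mul c⁻¹)
      (fun Q hQ x hx => ?_) (fun Q hQ => ?_) (r := ENNReal.ofReal (2 ^ (-ε)))
      fun j Q hQ A hAQ hA hvol => ?_).trans ?_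
    · exact le_iSup_of_le Q (le_iSup_of_le (hcube Q hQ) (le_iSup_of_le hx le_rfl))
    · have := weightMeasure_le_luxemburgNorm hε hε1 hw (hcube Q hQ).volume_ne_zero
        (hcube Q hQ).volume_ne_top subset_rfl (hcube Q hQ).measurableSet le_rfl (by simp)
      simpa using this
    · exact weightMeasure_le_of_volume_le_two_pow hε hε1 hw (hcube Q hQ).volume_ne_zero
        (hcube Q hQ).volume_ne_top hAQ hA j hvol
    · simp only [mul_assoc c⁻¹]
      rw [lintegral_const_mul' _ _ (ENNReal.inv_ne_top.2 hc0)]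
      gcongr
      calc 32 + 128 * (1 - ENNReal.ofReal (2 ^ (-ε)))⁻¹
          ≤ ENNReal.ofReal (32 / ε) + ENNReal.ofReal 128 * ENNReal.ofReal (2 / ε) := by
            gcongr
            · rw [← ENNReal.ofReal_ofNat 32]
              refine ENNReal.ofReal_le_ofReal ?_
              rw [le_div_iff₀ hε]; linarith
            · simp
            · exact inv_one_sub_two_rpow_neg_le hε hε1
        _ = ENNReal.ofReal (288 / ε) := by
            rw [← ENNReal.ofReal_mul (by norm_num),
              ← ENNReal.ofReal_add (by positivity) (by positivity)]
            congr 1; ring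
  have hunion : {x | c < absSparseOp S f x} = ⋃ F : Finset S, {x | c < ∑ Q ∈ F, h Q x} := by
    ext x
    rw [mem_ofPred_eq, absSparseOp, ENNReal.tsum_eq_iSup_sum, lt_iSup_iff, mem_iUnion]
    rfl
  have hdir : Directed (· ⊆ ·) fun F : Finset S => {x | c < ∑ Q ∈ F, h Q x} := by
    refine Monotone.directed_le fun F F' hFF' x hx => ?_
    rw [mem_ofPred_eq] at hx ⊢
    exact hx.trans_le (Finset.sum_le_sum_of_subset hFF')
  rw [hunion, hdir.measure_iUnion]
  calc c * ⨆ F : Finset S, weightMeasure w {x | c < ∑ Q ∈ F, h Q x}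
      ≤ c * (ENNReal.ofReal (288 / ε) * (c⁻¹ * I)) := by
        gcongr
        exact iSup_le hfinite
    _ = (c * c⁻¹) * (ENNReal.ofReal (288 / ε) * I) := by ring
    _ = _ := by rw [ENNReal.mul_inv_cancel hc0 hct, one_mul]

end SparseOperator

end SparseEndpoint

theorem mainTheorem5 (n : ℕ) (hn : 1 ≤ n) :
    ∃ c : ℝ, 0 < c ∧
      ∀ D : Set (Set (Fin n → ℝ)), IsDyadicGrid D →
      ∀ S : Set (Set (Fin n → ℝ)), S ⊆ D → IsSparse S →
      ∀ ε : ℝ, 0 < ε → ε ≤ 1 →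
      ∀ w : (Fin n → ℝ) → ℝ, (∀ x, 0 ≤ w x) → LocallyIntegrable w volume →
      ∀ f : (Fin n → ℝ) → ℂ, LocallyIntegrable f volume →
        ((∫⁻ x, ‖f x‖ₑ * orliczMaximal (youngLLogL ε) w x) < ∞ →
          ∀ᵐ x ∂(weightMeasure w), Summable fun Q : S => sparseTerm f x (Q : Set (Fin n → ℝ))) ∧
        weakL1Norm (weightMeasure w) (sparseOp S f) ≤
          ENNReal.ofReal (c / ε) * ∫⁻ x, ‖f x‖ₑ * orliczMaximal (youngLLogL ε) w x := by
  refine ⟨288, by norm_num, fun D hD S hSD hS ε hε hε1 w hw hwi f hf => ⟨fun hI => ?_, ?_⟩⟩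
  · have key := fun (t : ℝ) (ht : 0 < t) =>
      mul_weightMeasure_absSparseOp_le hD hSD hS hε hε1 hw hwi hf ht
    set B := ENNReal.ofReal (288 / ε) * ∫⁻ x, ‖f x‖ₑ * orliczMaximal (youngLLogL ε) w x with hB
    have hBt : B ≠ ∞ := ENNReal.mul_ne_top ENNReal.ofReal_ne_top hI.ne
    have hnull : weightMeasure w {x | absSparseOp S f x = ∞} = 0 := by
      by_contra hne
      -- A set of positive measure would violate the weak-type bound at a large height.
      have hle : ∀ k : ℕ, (k : ℝ≥0∞) * weightMeasure w {x | absSparseOp S f x = ∞} ≤ B := by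
        intro k
        refine le_trans ?_ (key (k + 1) (by positivity))
        gcongr
        · rw [← ENNReal.ofReal_natCast]
          exact ENNReal.ofReal_le_ofReal (by linarith)
        · intro h
          rw [h]
          exact ENNReal.ofReal_lt_top
      obtain ⟨k, hk⟩ := ENNReal.exists_nat_mul_gt hne hBt
      exact absurd (hle k) (not_le.2 hk)
    have hae : ∀ᵐ x ∂(weightMeasure w), absSparseOp S f x ≠ ∞ := by
      rw [ae_iff]; simpa using hnull
    filter_upwards [hae] with x hx using summable_sparseTerm hx
  · refine iSup₂_le fun t ht => le_trans ?_
      (mul_weightMeasure_absSparseOp_le hD hSD hS hε hε1 hw hwi hf ht)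
    gcongr with x
    intro hx
    refine lt_of_lt_of_le ?_ (enorm_sparseOp_le S f x)
    rw [← ofReal_norm]
    exact (ENNReal.ofReal_lt_ofReal_iff_of_nonneg ht.le).2 hx
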